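/- **Definitions.** An MV-algebra is $(A,\oplus,\neg,0)$ with $(A,\oplus,0)$ a commutative monoid, $\neg\neg x=x$, $x\oplus\neg 0=\neg 0$, $\neg(\neg x\oplus y)\oplus y=\neg(\neg y\oplus x)\oplus x$; put $u=\neg 0$, $x\ominus y=\neg(\neg x\oplus y)$, $x\odot y=\neg(\neg x\oplus\neg y)$, and $x\le y$ iff $x\ominus y=0$ (a lattice order). A $PMV_f$-algebra is an MV-algebra with a commutative associative product such that $a0=0$, $a(b\oplus c)\le ab\oplus ac$, $ab\ominus ac\le a(b\ominus c)$, $ab\le a\wedge b$ and $a(b\ominus c)=ab\ominus ac$. Every Boolean algebra is a $PMV_f$-algebra with $\oplus=\vee$, $\neg$ the complement and product $\wedge$. For a totally ordered $PMV_f$-algebra $C$, the lattice-ordered ring $C^\sharp$ consists of the pairs $(m,a)\in\mathbb Z\times C$, with $(m+1,0)$ identified with $(m,u)$, ordered lexicographically, with $(m,a)+(n,b)=(m+n,a\oplus b)$ if $a\oplus b\ne u$, $(m,a)+(n,b)=(m+n+1,a\odot b)$ if $a\oplus b=u$, $-(m,a)=(-m-1,\neg a)$, and $(m,a)(n,b)=mn(0,u^2)+m(0,bu)+n(0,au)+(0,ab)$.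 For an arbitrary $PMV_f$-algebra $A$, $A^\sharp$ is the $l$-subring (subring closed under $\vee,\wedge$) of $\prod_{P}(A/P)^\sharp$, with $P$ running over the prime ideals of the MV-algebra $A$, generated by the elements $\iota(a)=\big((0,[a]_P)\big)_P$, $a\in A$. It is ordered componentwise and its distinguished unit is $\iota(u)$. For a set $X$ let $B(\mathbb Z^X)$ be the ring of bounded functions $X\to\mathbb Z$, ordered pointwise, and regard $f\in 2^X$ as a function $X\to\{0,1\}\subset\mathbb Z$. **Statement.** 1. For every set $X$ there is an isomorphism of lattice-ordered rings $(2^X)^\sharp\cong B(\mathbb Z^X)$ that sends $\iota(f)$ to $f$ for all $f\in 2^X$; in particular it sends the unit $\iota(u)$ to $1$. 2. For every $n\in\mathbb N$ there is likewise an isomorphism of lattice-ordered rings $(2^n)^\sharp\cong\mathbb Z^n$ that sends $\iota(f)$ to $f$. 3. For every Boolean algebra $B$ there are a set $X$, an injective homomorphism of $PMV_f$-algebras $h\colon B\to 2^X$, and an injective homomorphism of rings $j\colon B^\sharp\to B(\mathbb Z^X)$ that preserves and reflects the order, preserves $\vee$ and $\wedge$, and satisfies $j(\iota(b))=h(b)$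 for all $b\in B$; so $B^\sharp$ is an $l$-subring of $B(\mathbb Z^X)$. -/

import Mathlib

universe u

/-! ### MV-algebras -/

/-- An MV-algebra `(A, ⊕, ¬, 0)`. -/
class MVAlgebra (A : Type u) where
  oplus : A → A → A
  neg : A → A
  zero : A
  oplus_assoc : ∀ x y z, oplus (oplus x y) z = oplus x (oplus y z)
  oplus_comm : ∀ x y, oplus x y = oplus y x
  oplus_zero : ∀ x, oplus x zero = x
  neg_neg : ∀ x, neg (neg x) = x
  oplus_neg_zero : ∀ x, oplus x (neg zero) = neg zero
  luk : ∀ x y, oplus (neg (oplus (neg x) y)) y = oplus (neg (oplus (neg y) x)) x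

infixl:65 " ⊕ᴹ " => MVAlgebra.oplus
prefix:max "¬ᴹ" => MVAlgebra.neg

namespace MVAlgebra

section Ops
variable {A : Type u} [MVAlgebra A]

/-- The top element `u = ¬0`. -/
def unit : A := ¬ᴹ(zero : A)
/-- `a ⊖ b = ¬(¬a ⊕ b)`. -/
def ominus (a b : A) : A := ¬ᴹ(¬ᴹa ⊕ᴹ b)
/-- `a ⊙ b = ¬(¬a ⊕ ¬b)`. -/
def odot (a b : A) : A := ¬ᴹ(¬ᴹa ⊕ᴹ ¬ᴹb)
/-- `a ∨ b = (a ⊖ b) ⊕ b`. -/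
def sup (a b : A) : A := ominus a b ⊕ᴹ b
/-- `a ∧ b = ¬(¬a ∨ ¬b)`. -/
def inf (a b : A) : A := ¬ᴹ(sup ¬ᴹa ¬ᴹb)
/-- The order of an MV-algebra: `a ≤ b` iff `a ⊖ b = 0`. -/
def le (a b : A) : Prop := ominus a b = zero

theorem neg_inj {a b : A} (h : ¬ᴹa = ¬ᴹb) : a = b := by
  rw [← neg_neg a, h, neg_neg]

theorem neg_unit : ¬ᴹ(unit : A) = zero := neg_neg _

theorem zero_oplus (a : A) : zero ⊕ᴹ a = a := by rw [oplus_comm, oplus_zero]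

theorem oplus_unit (a : A) : a ⊕ᴹ unit = unit := oplus_neg_zero a

theorem unit_oplus (a : A) : unit ⊕ᴹ a = unit := by rw [oplus_comm, oplus_unit]

theorem oplus_left_comm (a b c : A) : a ⊕ᴹ (b ⊕ᴹ c) = b ⊕ᴹ (a ⊕ᴹ c) := by
  rw [← oplus_assoc, oplus_comm a b, oplus_assoc]

theorem neg_oplus_self (a : A) : ¬ᴹa ⊕ᴹ a = unit := by
  have h := luk a unit
  rw [oplus_unit, neg_unit, zero_oplus] at h
  exact h.symm

theorem oplus_neg_self (a : A) : a ⊕ᴹ ¬ᴹa = unit := by rw [oplus_comm, neg_oplus_self]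

theorem le_iff {a b : A} : le a b ↔ ¬ᴹa ⊕ᴹ b = unit := by
  constructor
  · intro h
    apply neg_inj
    rw [neg_unit]; exact h
  · intro h
    change ¬ᴹ(¬ᴹa ⊕ᴹ b) = zero
    rw [h, neg_unit]

theorem le_refl (a : A) : le a a := le_iff.2 (neg_oplus_self a)

theorem ominus_oplus_of_le {a b : A} (h : le b a) : ominus a b ⊕ᴹ b = a := by
  unfold ominus
  rw [luk, le_iff.1 h, neg_unit, zero_oplus]

theorem le_antisymm {a b : A} (h : le a b) (h' : le b a) : a = b := by
  have := luk a b
  rw [le_iff.1 h, le_iff.1 h', neg_unit, zero_oplus, zero_oplus] at this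
  exact this.symm

theorem le_oplus (a c : A) : le a (a ⊕ᴹ c) := by
  rw [le_iff, ← oplus_assoc, neg_oplus_self, unit_oplus]

theorem le_trans {a b c : A} (h : le a b) (h' : le b c) : le a c := by
  have e : c = a ⊕ᴹ (ominus b a ⊕ᴹ ominus c b) := by
    rw [← oplus_assoc, oplus_comm a, ominus_oplus_of_le h, oplus_comm, ominus_oplus_of_le h']
  rw [e]
  exact le_oplus _ _

theorem zero_le (a : A) : le zero a := by
  rw [le_iff]; exact unit_oplus a

theorem le_unit (a : A) : le a unit := le_iff.2 (oplus_unit _)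

theorem neg_le_neg {a b : A} (h : le a b) : le ¬ᴹb ¬ᴹa := by
  rw [le_iff, neg_neg, oplus_comm]; exact le_iff.1 h

theorem oplus_le_oplus_right {a b : A} (h : le a b) (c : A) : le (a ⊕ᴹ c) (b ⊕ᴹ c) := by
  have e : b ⊕ᴹ c = (a ⊕ᴹ c) ⊕ᴹ ominus b a := by
    have hb := ominus_oplus_of_le h
    rw [oplus_assoc, oplus_comm c, ← oplus_assoc, oplus_comm a, hb]
  rw [e]
  exact le_oplus _ _

theorem oplus_le_oplus {a b c d : A} (h : le a b) (h' : le c d) : le (a ⊕ᴹ c) (b ⊕ᴹ d) := by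
  refine le_trans (oplus_le_oplus_right h c) ?_
  rw [oplus_comm b c, oplus_comm b d]
  exact oplus_le_oplus_right h' b

theorem ominus_le_iff {a b c : A} : le (ominus a b) c ↔ le a (b ⊕ᴹ c) := by
  rw [le_iff, le_iff]
  unfold ominus
  rw [neg_neg, oplus_assoc]

theorem le_zero {a : A} (h : le a zero) : a = zero := le_antisymm h (zero_le a)

theorem ominus_self (a : A) : ominus a a = zero := le_refl a

theorem oplus_ominus_of_le_neg {a b : A} (h : le a ¬ᴹb) : ominus (a ⊕ᴹ b) b = a := by
  apply neg_inj
  have h' : le b ¬ᴹa := by have := neg_le_neg h; rwa [neg_neg] at this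
  have := ominus_oplus_of_le h'
  unfold ominus at this ⊢
  rwa [neg_neg] at this ⊢

theorem odot_comm (a b : A) : odot a b = odot b a := by
  unfold odot; rw [oplus_comm]

theorem odot_eq_ominus (a b : A) : odot a b = ominus a ¬ᴹb := rfl

theorem odot_eq_zero {a b : A} : odot a b = zero ↔ le a ¬ᴹb := Iff.rfl

theorem odot_le_left (a b : A) : le (odot a b) a := by
  rw [odot_eq_ominus, ominus_le_iff, oplus_comm]; exact le_oplus _ _

theorem ominus_le_left (a b : A) : le (ominus a b) a := by
  rw [ominus_le_iff, oplus_comm]; exact le_oplus _ _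

theorem oplus_eq_unit {a b : A} : a ⊕ᴹ b = unit ↔ le ¬ᴹa b := by
  rw [le_iff, neg_neg]

theorem le_sup_left (a b : A) : le a (sup a b) := by
  unfold sup; rw [oplus_comm, ← ominus_le_iff]; exact le_refl _

theorem le_sup_right (a b : A) : le b (sup a b) := by
  unfold sup; rw [oplus_comm]; exact le_oplus _ _

theorem inf_le_left (a b : A) : le (inf a b) a := by
  have := neg_le_neg (le_sup_left ¬ᴹa ¬ᴹb)
  rwa [neg_neg] at this

theorem inf_le_right (a b : A) : le (inf a b) b := by
  have := neg_le_neg (le_sup_right ¬ᴹa ¬ᴹb)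
  rwa [neg_neg] at this

theorem inf_eq (a b : A) : inf a b = odot b (¬ᴹb ⊕ᴹ a) := by
  unfold inf sup odot ominus
  rw [neg_neg, oplus_comm, oplus_comm a]

theorem odot_assoc (a b c : A) : odot (odot a b) c = odot a (odot b c) := by
  unfold odot; rw [neg_neg, neg_neg, oplus_assoc]

theorem odot_left_comm (a b c : A) : odot a (odot b c) = odot b (odot a c) := by
  rw [← odot_assoc, odot_comm a b, odot_assoc]

theorem inf_comm (a b : A) : inf a b = inf b a := by
  unfold inf sup ominus
  rw [luk]

theorem odot_mono {a b : A} (h : le a b) (c : A) : le (odot c a) (odot c b) := by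
  unfold odot
  apply neg_le_neg
  rw [oplus_comm, oplus_comm ¬ᴹc]
  exact oplus_le_oplus_right (neg_le_neg h) _

/-- Prelinearity: `(x ⊖ y) ∧ (y ⊖ x) = 0`. -/
theorem prelinear (x y : A) : inf (ominus x y) (ominus y x) = zero := by
  rw [inf_comm, inf_eq]
  have e1 : (ominus x y : A) = odot x ¬ᴹy := by unfold odot ominus; rw [neg_neg]
  have e2 : ¬ᴹ(ominus x y : A) = ¬ᴹx ⊕ᴹ y := by unfold ominus; rw [neg_neg]
  rw [e2, e1]
  set d := ominus y x with hd
  set w := y ⊕ᴹ d with hw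
  have h1 : odot (odot x ¬ᴹy) (¬ᴹx ⊕ᴹ y ⊕ᴹ d) = odot ¬ᴹy (inf w x) := by
    rw [inf_eq, oplus_assoc, odot_comm x, odot_assoc]
  have h2 : odot ¬ᴹy (inf w x) = odot (¬ᴹw ⊕ᴹ x) (inf d ¬ᴹy) := by
    rw [inf_comm w x, inf_eq x w, inf_eq d, neg_neg, ← hw, ← odot_assoc, odot_comm]
  have h3 : odot (¬ᴹw ⊕ᴹ x) (inf d ¬ᴹy) = odot (y) (odot (inf ¬ᴹw ¬ᴹx) (¬ᴹd ⊕ᴹ ¬ᴹy)) := by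
    rw [inf_comm d, inf_eq _ d, inf_eq ¬ᴹw, neg_neg]
    have : d = odot y ¬ᴹx := by rw [hd]; unfold odot ominus; rw [neg_neg]
    have h : ∀ z : A, odot d z = odot y (odot ¬ᴹx z) := by intro z; rw [this, odot_assoc]
    rw [h, odot_left_comm, odot_assoc, odot_left_comm _ ¬ᴹx, oplus_comm x]
  rw [h1, h2, h3]
  apply le_zero
  have hle : le (odot (inf ¬ᴹw ¬ᴹx) (¬ᴹd ⊕ᴹ ¬ᴹy)) ¬ᴹy :=
    le_trans (odot_le_left _ _) (le_trans (inf_le_left _ _) (neg_le_neg (le_oplus _ _)))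
  refine le_trans (odot_mono hle y) ?_
  have : odot y ¬ᴹy = zero := by rw [odot_eq_zero, neg_neg]; exact le_refl y
  rw [this]; exact le_refl _

/-- Ideals of an MV-algebra. -/
structure IsIdeal (I : Set A) : Prop where
  nonempty : I.Nonempty
  down : ∀ {a b}, le a b → b ∈ I → a ∈ I
  oplus_mem : ∀ {a b}, a ∈ I → b ∈ I → a ⊕ᴹ b ∈ I

/-- Prime ideals of an MV-algebra. (The improper ideal is allowed, and is harmless: the chain
`A / A` is trivial and so is the ring attached to it below.) -/
structure IsPrime (P : Set A) : Prop extends IsIdeal P where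
  prime : ∀ {a b}, inf a b ∈ P → a ∈ P ∨ b ∈ P

theorem IsIdeal.zero_mem {I : Set A} (hI : IsIdeal I) : zero ∈ I := by
  obtain ⟨a, ha⟩ := hI.nonempty
  exact hI.down (zero_le a) ha

/-- `a ≡ b` modulo `I` iff `(a ⊖ b) ⊕ (b ⊖ a) ∈ I`. -/
def cong (I : Set A) (a b : A) : Prop := ominus a b ⊕ᴹ ominus b a ∈ I

theorem cong_iff {I : Set A} (hI : IsIdeal I) {a b : A} :
    cong I a b ↔ ominus a b ∈ I ∧ ominus b a ∈ I := by
  constructor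
  · intro h
    refine ⟨hI.down (le_oplus _ _) h, hI.down ?_ h⟩
    rw [oplus_comm]; exact le_oplus _ _
  · rintro ⟨h, h'⟩
    exact hI.oplus_mem h h'

theorem ominus_triangle (a b c : A) : le (ominus a c) (ominus a b ⊕ᴹ ominus b c) := by
  rw [ominus_le_iff]
  have h1 : le b (c ⊕ᴹ ominus b c) := ominus_le_iff.1 (le_refl _)
  have h2 : le a (b ⊕ᴹ ominus a b) := ominus_le_iff.1 (le_refl _)
  refine le_trans h2 (le_trans (oplus_le_oplus_right h1 _) ?_)
  rw [oplus_assoc, oplus_comm (ominus b c)]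
  exact le_refl _

theorem ominus_oplus_le (a b c d : A) :
    le (ominus (a ⊕ᴹ b) (c ⊕ᴹ d)) (ominus a c ⊕ᴹ ominus b d) := by
  rw [ominus_le_iff]
  have h1 : le a (c ⊕ᴹ ominus a c) := ominus_le_iff.1 (le_refl _)
  have h2 : le b (d ⊕ᴹ ominus b d) := ominus_le_iff.1 (le_refl _)
  refine le_trans (oplus_le_oplus h1 h2) ?_
  rw [oplus_assoc, oplus_assoc, oplus_left_comm (ominus a c)]
  exact le_refl _

theorem ominus_neg_neg (a b : A) : ominus ¬ᴹa ¬ᴹb = ominus b a := by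
  unfold ominus; rw [neg_neg, oplus_comm]

/-- The congruence of a prime ideal. -/
def primeSetoid {P : Set A} (hP : IsPrime P) : Setoid A where
  r := cong P
  iseqv := by
    have hI := hP.toIsIdeal
    refine ⟨fun a => ?_, fun {a b} h => ?_, fun {a b c} h h' => ?_⟩
    · rw [cong_iff hI, ominus_self]; exact ⟨hI.zero_mem, hI.zero_mem⟩
    · rw [cong_iff hI] at h ⊢; exact h.symm
    · rw [cong_iff hI] at h h' ⊢
      exact ⟨hI.down (ominus_triangle a b c) (hI.oplus_mem h.1 h'.1),
        hI.down (ominus_triangle c b a) (hI.oplus_mem h'.2 h.2)⟩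

end Ops

/-- Totally ordered MV-algebras. -/
class IsChain (A : Type u) [MVAlgebra A] : Prop where
  total : ∀ a b : A, le a b ∨ le b a

/-- The prime spectrum. -/
def Spec (A : Type u) [MVAlgebra A] : Type u := {P : Set A // IsPrime P}

/-- The quotient `A / P`. -/
def PrimeQuotient {A : Type u} [MVAlgebra A] (P : Spec A) : Type u :=
  Quotient (primeSetoid P.2)

section Quot
variable {A : Type u} [MVAlgebra A]

/-- The class `[a]_P`. -/
def PrimeQuotient.mk (P : Spec A) (a : A) : PrimeQuotient P := Quotient.mk (primeSetoid P.2) a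

theorem PrimeQuotient.sound (P : Spec A) {a b : A} (h : cong P.1 a b) :
    PrimeQuotient.mk P a = PrimeQuotient.mk P b := Quotient.sound (s := primeSetoid P.2) h

theorem PrimeQuotient.ind (P : Spec A) {C : PrimeQuotient P → Prop}
    (h : ∀ a, C (PrimeQuotient.mk P a)) (x : PrimeQuotient P) : C x :=
  Quotient.inductionOn (s := primeSetoid P.2) x h

instance PrimeQuotient.instMVAlgebra (P : Spec A) : MVAlgebra (PrimeQuotient P) where
  oplus := Quotient.map₂ (sa := primeSetoid P.2) (sb := primeSetoid P.2) (sc := primeSetoid P.2)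
    oplus (by
      intro a b h c d h'
      have hI := P.2.toIsIdeal
      have h := (cong_iff hI).1 h
      have h' := (cong_iff hI).1 h'
      exact (cong_iff hI).2 ⟨hI.down (ominus_oplus_le _ _ _ _) (hI.oplus_mem h.1 h'.1),
        hI.down (ominus_oplus_le _ _ _ _) (hI.oplus_mem h.2 h'.2)⟩)
  neg := Quotient.map (sa := primeSetoid P.2) (sb := primeSetoid P.2) neg (by
      intro a b h
      have hI := P.2.toIsIdeal
      have h := (cong_iff hI).1 h
      refine (cong_iff hI).2 ?_
      rw [ominus_neg_neg, ominus_neg_neg]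
      exact h.symm)
  zero := PrimeQuotient.mk P zero
  oplus_assoc := PrimeQuotient.ind P fun a => PrimeQuotient.ind P fun b =>
    PrimeQuotient.ind P fun c => congrArg (PrimeQuotient.mk P) (oplus_assoc a b c)
  oplus_comm := PrimeQuotient.ind P fun a => PrimeQuotient.ind P fun b =>
    congrArg (PrimeQuotient.mk P) (oplus_comm a b)
  oplus_zero := PrimeQuotient.ind P fun a => congrArg (PrimeQuotient.mk P) (oplus_zero a)
  neg_neg := PrimeQuotient.ind P fun a => congrArg (PrimeQuotient.mk P) (neg_neg a)
  oplus_neg_zero := PrimeQuotient.ind P fun a =>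
    congrArg (PrimeQuotient.mk P) (oplus_neg_zero a)
  luk := PrimeQuotient.ind P fun a => PrimeQuotient.ind P fun b =>
    congrArg (PrimeQuotient.mk P) (luk a b)

theorem PrimeQuotient.mk_eq_zero (P : Spec A) {a : A} (h : a ∈ P.1) :
    PrimeQuotient.mk P a = zero := by
  refine PrimeQuotient.sound P ((cong_iff P.2.toIsIdeal).2 ⟨?_, ?_⟩)
  · exact P.2.down (ominus_le_left _ _) h
  · exact P.2.down (le_trans (ominus_le_left _ _) (zero_le _)) h

instance PrimeQuotient.instIsChain (P : Spec A) : IsChain (PrimeQuotient P) where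
  total := PrimeQuotient.ind P fun a => PrimeQuotient.ind P fun b => by
    have h : inf (ominus a b) (ominus b a) ∈ P.1 := by
      rw [prelinear]; exact P.2.toIsIdeal.zero_mem
    rcases P.2.prime h with h | h
    · exact Or.inl (PrimeQuotient.mk_eq_zero P h)
    · exact Or.inr (PrimeQuotient.mk_eq_zero P h)

end Quot

end MVAlgebra

open MVAlgebra in
/-- A (commutative) MVW-rig: an MV-algebra with a commutative associative product such that
`a0 = 0`, `a(b ⊕ c) ≤ ab ⊕ ac` and `ab ⊖ ac ≤ a(b ⊖ c)`. -/
class MVWRig (A : Type u) extends MVAlgebra A where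
  mul : A → A → A
  mul_assoc : ∀ a b c, mul (mul a b) c = mul a (mul b c)
  mul_comm : ∀ a b, mul a b = mul b a
  mul_zero : ∀ a, mul a zero = zero
  mul_oplus_le : ∀ a b c, ominus (mul a (b ⊕ᴹ c)) (mul a b ⊕ᴹ mul a c) = zero
  ominus_mul_le : ∀ a b c,
    ominus (ominus (mul a b) (mul a c)) (mul a (ominus b c)) = zero

infixl:70 " *ᴹ " => MVWRig.mul

open MVAlgebra in
/-- A `PMV_f`-algebra: an MVW-rig with `ab ≤ a ∧ b` and `a(b ⊖ c) = ab ⊖ ac`. -/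
class PMVf (A : Type u) extends MVWRig A where
  mul_le_inf : ∀ a b : A, le (a *ᴹ b) (inf a b)
  mul_ominus : ∀ a b c : A, a *ᴹ ominus b c = ominus (a *ᴹ b) (a *ᴹ c)

namespace PMVf
open MVAlgebra

/-- Homomorphisms of `PMV_f`-algebras. -/
structure IsHom {A B : Type*} [PMVf A] [PMVf B] (h : A → B) : Prop where
  map_zero : h zero = zero
  map_oplus : ∀ a b, h (a ⊕ᴹ b) = h a ⊕ᴹ h b
  map_neg : ∀ a, h ¬ᴹa = ¬ᴹ(h a)
  map_mul : ∀ a b, h (a *ᴹ b) = h a *ᴹ h b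

/-- A Boolean algebra as a `PMV_f`-algebra: sum the supremum, negation the complement and
product the infimum. -/
instance ofBooleanAlgebra (B : Type u) [BooleanAlgebra B] : PMVf B where
  oplus a b := a ⊔ b
  neg a := aᶜ
  zero := ⊥
  oplus_assoc := _root_.sup_assoc
  oplus_comm := _root_.sup_comm
  oplus_zero a := by simp
  neg_neg a := by simp
  oplus_neg_zero a := by simp
  luk a b := by
    simp only [compl_sup, compl_compl]
    rw [sup_inf_right, sup_inf_right, compl_sup_eq_top, compl_sup_eq_top, inf_top_eq, inf_top_eq,
      _root_.sup_comm]
  mul a b := a ⊓ b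
  mul_assoc := _root_.inf_assoc
  mul_comm := _root_.inf_comm
  mul_zero a := by simp
  mul_oplus_le a b c := by
    change ((a ⊓ (b ⊔ c))ᶜ ⊔ (a ⊓ b ⊔ a ⊓ c))ᶜ = ⊥
    rw [← inf_sup_left, compl_sup_eq_top, compl_top]
  ominus_mul_le a b c := by
    change ((((a ⊓ b)ᶜ ⊔ (a ⊓ c))ᶜ)ᶜ ⊔ (a ⊓ (bᶜ ⊔ c)ᶜ))ᶜ = ⊥
    have h : (((a ⊓ b)ᶜ ⊔ (a ⊓ c))ᶜ) = a ⊓ (bᶜ ⊔ c)ᶜ := by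
      simp only [compl_sup, compl_compl, compl_inf]
      rw [inf_sup_left, inf_right_comm a b, inf_compl_self, bot_inf_eq, bot_sup_eq, inf_assoc]
    rw [h, compl_sup_eq_top, compl_top]
  mul_le_inf a b := by
    change ((a ⊓ b)ᶜ ⊔ ((aᶜᶜ ⊔ bᶜ)ᶜ ⊔ bᶜ)ᶜ)ᶜ = ⊥
    have h : ((aᶜᶜ ⊔ bᶜ)ᶜ ⊔ bᶜ)ᶜ = a ⊓ b := by
      simp only [compl_sup, compl_compl, compl_inf]
      rw [inf_sup_right, compl_inf_eq_bot, sup_bot_eq]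
    rw [h, compl_sup_eq_top, compl_top]
  mul_ominus a b c := by
    change a ⊓ (bᶜ ⊔ c)ᶜ = ((a ⊓ b)ᶜ ⊔ (a ⊓ c))ᶜ
    simp only [compl_sup, compl_compl, compl_inf]
    rw [inf_sup_left, inf_right_comm a b, inf_compl_self, bot_inf_eq, bot_sup_eq, inf_assoc]

section
variable {A : Type u} [PMVf A]

theorem mul_le_left (a b : A) : le (a *ᴹ b) a := MVAlgebra.le_trans (mul_le_inf a b) (inf_le_left a b)

theorem mul_mono (x : A) {a b : A} (h : le a b) : le (x *ᴹ a) (x *ᴹ b) := by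
  change ominus _ _ = zero
  rw [← mul_ominus]
  have : ominus a b = zero := h
  rw [this, MVWRig.mul_zero]

theorem mul_cong (P : Spec A) (x : A) {a b : A} (h : cong P.1 a b) :
    cong P.1 (x *ᴹ a) (x *ᴹ b) := by
  have hI := P.2.toIsIdeal
  have h := (cong_iff hI).1 h
  refine (cong_iff hI).2 ?_
  rw [← mul_ominus, ← mul_ominus, MVWRig.mul_comm x, MVWRig.mul_comm x]
  exact ⟨hI.down (mul_le_left _ _) h.1, hI.down (mul_le_left _ _) h.2⟩

/-- The quotient of a `PMV_f`-algebra by a prime ideal is a `PMV_f`-algebra. -/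
instance instPrimeQuotient (P : Spec A) : PMVf (PrimeQuotient P) where
  mul := Quotient.map₂ (sa := primeSetoid P.2) (sb := primeSetoid P.2) (sc := primeSetoid P.2)
    MVWRig.mul (by
      intro a b h c d h'
      refine (primeSetoid P.2).trans (mul_cong P a h') ?_
      rw [MVWRig.mul_comm a, MVWRig.mul_comm b]
      exact mul_cong P d h)
  mul_assoc := PrimeQuotient.ind P fun a => PrimeQuotient.ind P fun b =>
    PrimeQuotient.ind P fun c => congrArg (PrimeQuotient.mk P) (MVWRig.mul_assoc a b c)
  mul_comm := PrimeQuotient.ind P fun a => PrimeQuotient.ind P fun b =>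
    congrArg (PrimeQuotient.mk P) (MVWRig.mul_comm a b)
  mul_zero := PrimeQuotient.ind P fun a => congrArg (PrimeQuotient.mk P) (MVWRig.mul_zero a)
  mul_oplus_le := PrimeQuotient.ind P fun a => PrimeQuotient.ind P fun b =>
    PrimeQuotient.ind P fun c => congrArg (PrimeQuotient.mk P) (MVWRig.mul_oplus_le a b c)
  ominus_mul_le := PrimeQuotient.ind P fun a => PrimeQuotient.ind P fun b =>
    PrimeQuotient.ind P fun c => congrArg (PrimeQuotient.mk P) (MVWRig.ominus_mul_le a b c)
  mul_le_inf := PrimeQuotient.ind P fun a => PrimeQuotient.ind P fun b =>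
    congrArg (PrimeQuotient.mk P) (mul_le_inf a b)
  mul_ominus := PrimeQuotient.ind P fun a => PrimeQuotient.ind P fun b =>
    PrimeQuotient.ind P fun c => congrArg (PrimeQuotient.mk P) (mul_ominus a b c)

end

end PMVf

/-! ### Chang's construction for chains -/

namespace MVAlgebra

section Chang
variable (A : Type u) [MVAlgebra A]

/-- The identification `(m + 1, 0) = (m, u)` on `ℤ × A`. -/
inductive ChangRel : ℤ × A → ℤ × A → Prop
  | glue (m : ℤ) : ChangRel (m + 1, zero) (m, unit)

/-- The carrier of Chang's group `A^*` of an MV-chain `A`: the pairs `(m, a) ∈ ℤ × A`, with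
`(m + 1, 0)` identified with `(m, u)`. -/
def Chang : Type u := Quot (ChangRel A)

end Chang

namespace Chang
variable {A : Type u} [MVAlgebra A]

/-- The element `(m, a)` of `A^*`. -/
def mk (m : ℤ) (a : A) : Chang A := Quot.mk _ (m, a)

theorem glue (m : ℤ) : mk (m + 1) (zero : A) = mk m unit := Quot.sound (ChangRel.glue m)

theorem ind {C : Chang A → Prop} (h : ∀ m a, C (mk m a)) (x : Chang A) : C x :=
  Quot.ind (fun p => h p.1 p.2) x

open Classical in
/-- `(m, a) + (n, b)` is `(m + n + 1, a ⊙ b)` if `a ⊕ b = u`, and `(m + n, a ⊕ b)` otherwise. -/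
noncomputable def addAux (p q : ℤ × A) : Chang A :=
  if p.2 ⊕ᴹ q.2 = unit then mk (p.1 + q.1 + 1) (odot p.2 q.2) else mk (p.1 + q.1) (p.2 ⊕ᴹ q.2)

theorem addAux_comm (p q : ℤ × A) : addAux p q = addAux q p := by
  unfold addAux
  rw [oplus_comm, odot_comm, add_comm p.1]

theorem addAux_glue (p : ℤ × A) (m : ℤ) : addAux p (m + 1, zero) = addAux p (m, unit) := by
  unfold addAux
  have h0 : odot p.2 unit = p.2 := by unfold odot; rw [neg_unit, oplus_zero, neg_neg]
  have h1 : odot p.2 (zero : A) = zero := by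
    unfold odot
    change ¬ᴹ(_ ⊕ᴹ unit) = _
    rw [oplus_unit, neg_unit]
  have h2 : p.2 ⊕ᴹ (zero : A) = p.2 := oplus_zero _
  simp only [h2, oplus_unit, if_true, h0, h1]
  split_ifs with h
  · rw [h2] at h
    rw [h, ← add_assoc, glue (p.1 + m + 1)]
  · rw [← add_assoc]

theorem addAux_rel (p q q' : ℤ × A) (h : ChangRel A q q') : addAux p q = addAux p q' := by
  cases h; exact addAux_glue _ _

noncomputable instance : Add (Chang A) where
  add := Quot.lift₂ addAux addAux_rel (fun p q r h => by
    rw [addAux_comm, addAux_comm q]; exact addAux_rel _ _ _ h)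

theorem mk_add_mk_of_oplus (m n : ℤ) {a b : A} (h : a ⊕ᴹ b = unit) :
    mk m a + mk n b = mk (m + n + 1) (odot a b) := if_pos h

theorem mk_add_mk_of_ne (m n : ℤ) {a b : A} (h : a ⊕ᴹ b ≠ unit) :
    mk m a + mk n b = mk (m + n) (a ⊕ᴹ b) := if_neg h

theorem mk_add_mk_of_odot (m n : ℤ) {a b : A} (h : odot a b = zero) :
    mk m a + mk n b = mk (m + n) (a ⊕ᴹ b) := by
  by_cases h' : a ⊕ᴹ b = unit
  · rw [mk_add_mk_of_oplus m n h', h, h', glue]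
  · exact mk_add_mk_of_ne m n h'

instance : Zero (Chang A) := ⟨mk 0 zero⟩

/-- `-(m, a) = (-m - 1, ¬a)`. -/
instance : Neg (Chang A) where
  neg := Quot.lift (fun p => mk (-p.1 - 1) ¬ᴹp.2) (by
    intro p q h
    cases h with
    | glue m =>
      change mk (-(m + 1) - 1) unit = mk (-m - 1) ¬ᴹunit
      rw [neg_unit, ← glue]
      congr 1; ring)

theorem neg_mk (m : ℤ) (a : A) : -mk m a = mk (-m - 1) ¬ᴹa := rfl

theorem zero_def : (0 : Chang A) = mk 0 zero := rfl

protected theorem add_comm (x y : Chang A) : x + y = y + x := by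
  induction x using ind with | _ m a =>
  induction y using ind with | _ n b =>
  exact addAux_comm _ _

protected theorem zero_add (x : Chang A) : 0 + x = x := by
  induction x using ind with | _ m a =>
  rw [zero_def, mk_add_mk_of_odot, zero_oplus, _root_.zero_add]
  rw [odot_eq_zero]; exact zero_le _

protected theorem neg_add (x : Chang A) : -x + x = 0 := by
  induction x using ind with | _ m a =>
  rw [neg_mk, mk_add_mk_of_oplus _ _ (neg_oplus_self a), zero_def]
  have : odot ¬ᴹa a = zero := le_refl _
  rw [this]
  congr 1; ring

theorem odot_or [IsChain A] (a b : A) : odot a b = zero ∨ a ⊕ᴹ b = unit := by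
  rw [odot_eq_zero, oplus_eq_unit]
  rcases IsChain.total a ¬ᴹb with h | h
  · exact Or.inl h
  · right; have := neg_le_neg h; rwa [neg_neg] at this

/-- If `a ≤ ¬b` and `b ≤ ¬c` then `(a ⊕ b) ⊙ c = a ⊙ (b ⊕ c)`. -/
theorem assoc_aux1 {a b c : A} (h : le b ¬ᴹa) (h' : le b ¬ᴹc) :
    odot (a ⊕ᴹ b) c = odot a (b ⊕ᴹ c) := by
  unfold odot
  congr 1
  have e1 : ¬ᴹ(a ⊕ᴹ b) = ominus ¬ᴹa b := by unfold ominus; rw [neg_neg]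
  have e2 : ¬ᴹ(b ⊕ᴹ c) = ominus ¬ᴹc b := by unfold ominus; rw [neg_neg, oplus_comm]
  rw [e1, e2]
  nth_rw 1 [← ominus_oplus_of_le h']
  nth_rw 2 [← ominus_oplus_of_le h]
  rw [oplus_assoc, oplus_comm b]

theorem assoc_aux2 {a b c : A} (h : a ⊕ᴹ b = unit) (h' : b ⊕ᴹ c = unit) :
    odot a b ⊕ᴹ c = a ⊕ᴹ odot b c := by
  rw [oplus_eq_unit] at h
  rw [oplus_comm, oplus_eq_unit] at h'
  have := assoc_aux1 (a := ¬ᴹa) (b := ¬ᴹb) (c := ¬ᴹc)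
    (by rw [neg_neg]; have := neg_le_neg h; rwa [neg_neg] at this)
    (by rw [neg_neg]; have := neg_le_neg h'; rwa [neg_neg] at this)
  unfold odot at this ⊢
  rw [neg_neg, neg_neg] at this
  exact neg_inj this

theorem assoc_aux3 {a b c : A} (h : odot a b = zero) (h' : b ⊕ᴹ c = unit) :
    odot (a ⊕ᴹ b) c = a ⊕ᴹ odot b c := by
  rw [odot_eq_zero] at h
  rw [oplus_comm, oplus_eq_unit] at h'
  have hb : odot b c ⊕ᴹ ¬ᴹc = b := ominus_oplus_of_le h'
  rw [odot_eq_ominus (a ⊕ᴹ b)]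
  nth_rw 1 [← hb]
  rw [← oplus_assoc]
  apply oplus_ominus_of_le_neg
  rw [neg_neg]
  have hc : le (odot b c) c := by rw [odot_comm]; exact odot_le_left _ _
  have hb' : ¬ᴹb = ominus c (odot b c) := by
    rw [← hb]
    unfold ominus
    rw [hb, oplus_comm, hb]
  rw [hb'] at h
  have := oplus_le_oplus_right h (odot b c)
  rwa [ominus_oplus_of_le hc] at this

theorem odot_zero_symm {a b : A} (h : odot a b = zero) : le b ¬ᴹa := by
  rw [odot_comm] at h; exact h

theorem assoc_C [IsChain A] {a b c : A} (m n k : ℤ) (h : odot a b = zero) (h' : b ⊕ᴹ c = unit) :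
    mk m a + mk n b + mk k c = mk m a + (mk n b + mk k c) := by
  rw [mk_add_mk_of_odot m n h, mk_add_mk_of_oplus n k h', mk_add_mk_of_oplus,
    mk_add_mk_of_odot, assoc_aux3 h h']
  · congr 1; ring
  · rw [← odot_assoc, h]; exact zero_le _
  · rw [oplus_assoc, h', oplus_unit]

protected theorem add_assoc [IsChain A] (x y z : Chang A) : x + y + z = x + (y + z) := by
  induction x using ind with | _ m a =>
  induction y using ind with | _ n b =>
  induction z using ind with | _ k c =>
  rcases odot_or a b with h | h <;> rcases odot_or b c with h' | h'
  · have e := assoc_aux1 (odot_zero_symm h) h'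
    rw [mk_add_mk_of_odot m n h, mk_add_mk_of_odot n k h']
    rcases odot_or (a ⊕ᴹ b) c with h2 | h2
    · rw [mk_add_mk_of_odot _ _ h2, mk_add_mk_of_odot _ _ (e ▸ h2), oplus_assoc, add_assoc]
    · rw [mk_add_mk_of_oplus _ _ h2, mk_add_mk_of_oplus _ _ (oplus_assoc a b c ▸ h2), e,
        add_assoc m]
  · exact assoc_C m n k h h'
  · rw [Chang.add_comm (mk m a), Chang.add_comm _ (mk k c), Chang.add_comm (mk m a),
      Chang.add_comm (mk n b) (mk k c)]
    exact (assoc_C k n m (by rw [odot_comm]; exact h') (by rw [oplus_comm]; exact h)).symm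
  · have e := assoc_aux2 h h'
    rw [mk_add_mk_of_oplus m n h, mk_add_mk_of_oplus n k h']
    rcases odot_or (odot a b) c with h2 | h2
    · rw [mk_add_mk_of_odot _ _ h2, mk_add_mk_of_odot _ _ (odot_assoc a b c ▸ h2), e]
      congr 1; ring
    · rw [mk_add_mk_of_oplus _ _ h2, mk_add_mk_of_oplus _ _ (e ▸ h2), odot_assoc]
      congr 1; ring

noncomputable instance [IsChain A] : AddCommGroup (Chang A) where
  add_assoc := Chang.add_assoc
  zero_add := Chang.zero_add
  add_zero x := by rw [Chang.add_comm, Chang.zero_add]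
  add_comm := Chang.add_comm
  neg_add_cancel := Chang.neg_add
  nsmul := nsmulRec
  zsmul := zsmulRec

/-- The element `(0, a)`. -/
def of (a : A) : Chang A := mk 0 a

theorem of_zero : of (zero : A) = 0 := rfl

theorem mk_zero_eq [IsChain A] (m : ℤ) : mk m (zero : A) = m • of unit := by
  have h : ∀ m : ℤ, mk (m + 1) (zero : A) = mk m zero + of unit := by
    intro m
    rw [of, mk_add_mk_of_odot, add_zero, zero_oplus, glue]
    rw [odot_eq_zero]; exact zero_le _
  induction m using Int.induction_on with
  | zero => rw [zero_smul]; rfl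
  | succ i hi => rw [h, hi, add_smul, one_smul]
  | pred i hi =>
    have := h (-(i : ℤ) - 1)
    rw [sub_add_cancel, hi] at this
    rw [sub_smul, one_smul, this, add_sub_cancel_right]

theorem mk_eq [IsChain A] (m : ℤ) (a : A) : mk m a = m • of unit + of a := by
  rw [← mk_zero_eq, of, mk_add_mk_of_odot, add_zero, zero_oplus]
  rw [odot_eq_zero]; exact zero_le _

theorem of_ominus [IsChain A] {a b : A} (h : le b a) : of (ominus a b) = of a - of b := by
  rw [eq_sub_iff_add_eq, of, of, mk_add_mk_of_odot, ominus_oplus_of_le h]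
  · rfl
  · rw [odot_eq_zero]
    apply neg_le_neg
    rw [oplus_comm]; exact le_oplus _ _

/-! The order. -/

/-- The lexicographic order on `ℤ × A`. -/
def lexLe (p q : ℤ × A) : Prop := p.1 < q.1 ∨ p.1 = q.1 ∧ le p.2 q.2

/-- The order of `A^*` is the one induced by the lexicographic order: `x ≤ y` if some
representatives of `x` and `y` are so ordered. -/
instance : LE (Chang A) where
  le x y := ∃ m a n b, x = mk m a ∧ y = mk n b ∧ lexLe (m, a) (n, b)

open Classical in
/-- The normal form of a pair. -/
noncomputable def nf (p : ℤ × A) : ℤ × A := if p.2 = unit then (p.1 + 1, zero) else p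

theorem mk_nf (p : ℤ × A) : mk (nf p).1 (nf p).2 = mk p.1 p.2 := by
  unfold nf
  split_ifs with h
  · rw [h]; exact glue _
  · rfl

theorem subsingleton_of_eq (h : (zero : A) = unit) : Subsingleton (Chang A) := by
  have h0 : ∀ a : A, a = zero := fun a => le_zero (h ▸ le_unit a)
  have h1 : ∀ m : ℤ, mk m (zero : A) = mk 0 zero := by
    have hs : ∀ m : ℤ, mk (m + 1) (zero : A) = mk m zero := fun m => (glue m).trans (by rw [h])
    intro m
    induction m using Int.induction_on with
    | zero => rfl
    | succ i hi => rw [hs, hi]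
    | pred i hi => rw [← hs, sub_add_cancel, hi]
  refine ⟨fun x y => ?_⟩
  induction x using ind with | _ m a =>
  induction y using ind with | _ n b =>
  rw [h0 a, h0 b, h1 m, h1 n]

theorem nf_eq_of_mk_eq (h0 : (zero : A) ≠ unit) {m n : ℤ} {a b : A} (h : mk m a = mk n b) :
    nf (m, a) = nf (n, b) := by
  have : ∀ p q : ℤ × A, ChangRel A p q → nf p = nf q := by
    intro p q h
    cases h
    simp [nf, h0]
  exact congrArg (Quot.lift nf this) h

theorem lexLe_trans {p q r : ℤ × A} (h : lexLe p q) (h' : lexLe q r) : lexLe p r := by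
  rcases h with h | ⟨h, h1⟩ <;> rcases h' with h' | ⟨h', h1'⟩
  · exact Or.inl (h.trans h')
  · exact Or.inl (h' ▸ h)
  · exact Or.inl (h ▸ h')
  · exact Or.inr ⟨h.trans h', le_trans h1 h1'⟩

theorem lexLe_antisymm {p q : ℤ × A} (h : lexLe p q) (h' : lexLe q p) : p = q := by
  rcases h with h | ⟨h, h1⟩ <;> rcases h' with h' | ⟨h', h1'⟩
  · omega
  · omega
  · omega
  · exact Prod.ext h (le_antisymm h1 h1')

theorem lexLe_total [IsChain A] (p q : ℤ × A) : lexLe p q ∨ lexLe q p := by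
  rcases lt_trichotomy p.1 q.1 with h | h | h
  · exact Or.inl (Or.inl h)
  · rcases IsChain.total p.2 q.2 with h' | h'
    · exact Or.inl (Or.inr ⟨h, h'⟩)
    · exact Or.inr (Or.inr ⟨h.symm, h'⟩)
  · exact Or.inr (Or.inl h)

theorem lexLe_nf {p q : ℤ × A} (h : lexLe p q) : lexLe (nf p) (nf q) := by
  obtain ⟨m, a⟩ := p
  obtain ⟨n, b⟩ := q
  unfold nf lexLe at *
  by_cases ha : a = unit <;> by_cases hb : b = unit
  · simp only [ha, hb, if_true] at *
    rcases h with h | h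
    · left; omega
    · right; exact ⟨by omega, le_refl _⟩
  · simp only [ha, if_true, if_neg hb] at *
    rcases h with h | ⟨h, h'⟩
    · rcases lt_or_eq_of_le (show m + 1 ≤ n by omega) with h2 | h2
      · exact Or.inl h2
      · exact Or.inr ⟨h2, zero_le _⟩
    · exact absurd (le_antisymm (le_unit _) h') hb
  · simp only [ha, hb, if_true, if_false] at *
    left
    rcases h with h | h <;> omega
  · simp only [ha, hb, if_false] at *
    exact h

theorem mk_le_mk_iff (h0 : (zero : A) ≠ unit) {m n : ℤ} {a b : A} :
    mk m a ≤ mk n b ↔ lexLe (nf (m, a)) (nf (n, b)) := by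
  constructor
  · rintro ⟨m', a', n', b', h1, h2, h⟩
    rw [nf_eq_of_mk_eq h0 h1, nf_eq_of_mk_eq h0 h2]
    exact lexLe_nf h
  · intro h
    exact ⟨_, _, _, _, (mk_nf (m, a)).symm, (mk_nf (n, b)).symm, h⟩

open Classical in
noncomputable instance [IsChain A] : LinearOrder (Chang A) where
  le_refl x := by
    induction x using ind with | _ m a =>
    exact ⟨m, a, m, a, rfl, rfl, Or.inr ⟨rfl, le_refl a⟩⟩
  le_trans x y z h h' := by
    by_cases h0 : (zero : A) = unit
    · have := subsingleton_of_eq h0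
      rwa [Subsingleton.elim x y]
    · induction x using ind with | _ m a =>
      induction y using ind with | _ n b =>
      induction z using ind with | _ k c =>
      rw [mk_le_mk_iff h0] at *
      exact lexLe_trans h h'
  le_antisymm x y h h' := by
    by_cases h0 : (zero : A) = unit
    · have := subsingleton_of_eq h0
      exact Subsingleton.elim x y
    · induction x using ind with | _ m a =>
      induction y using ind with | _ n b =>
      rw [mk_le_mk_iff h0] at *
      have := lexLe_antisymm h h'
      have e := mk_nf (m, a)
      rw [this, mk_nf] at e
      exact e.symm
  le_total x y := by
    induction x using ind with | _ m a =>
    induction y using ind with | _ n b =>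
    rcases lexLe_total (m, a) (n, b) with h | h
    · exact Or.inl ⟨_, _, _, _, rfl, rfl, h⟩
    · exact Or.inr ⟨_, _, _, _, rfl, rfl, h⟩
  toDecidableLE := fun _ _ => Classical.propDecidable _

end Chang

end MVAlgebra

/-! ### The ring of a `PMV_f`-chain -/

namespace MVAlgebra.Chang
open PMVf
variable {A : Type u} [PMVf A] [IsChain A]

/-- `(m, a)(n, b) = mn(0, u²) + m(0, bu) + n(0, au) + (0, ab)`. -/
noncomputable def mulAux (p q : ℤ × A) : Chang A :=
  (p.1 * q.1) • of (unit *ᴹ unit) + p.1 • of (q.2 *ᴹ unit) + q.1 • of (p.2 *ᴹ unit)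
    + of (p.2 *ᴹ q.2)

theorem mulAux_comm (p q : ℤ × A) : mulAux p q = mulAux q p := by
  unfold mulAux
  rw [mul_comm p.1, MVWRig.mul_comm p.2 q.2]
  abel

theorem mulAux_rel (p q q' : ℤ × A) (h : ChangRel A q q') : mulAux p q = mulAux p q' := by
  cases h with
  | glue m =>
    unfold mulAux
    rw [MVWRig.mul_comm zero, MVWRig.mul_zero, MVWRig.mul_zero, of_zero]
    rw [mul_add, add_smul, add_smul]
    simp only [mul_one, one_smul, smul_zero]
    abel

noncomputable instance : Mul (Chang A) where
  mul := Quot.lift₂ mulAux mulAux_rel (fun p q r h => by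
    rw [mulAux_comm, mulAux_comm q]; exact mulAux_rel _ _ _ h)

theorem mk_mul_mk (m n : ℤ) (a b : A) : mk m a * mk n b =
    (m * n) • of (unit *ᴹ unit) + m • of (b *ᴹ unit) + n • of (a *ᴹ unit) + of (a *ᴹ b) := rfl

theorem of_mul_ominus (x : A) {a b : A} (h : le b a) :
    of (x *ᴹ ominus a b) = of (x *ᴹ a) - of (x *ᴹ b) := by
  rw [mul_ominus, of_ominus (mul_mono x h)]

theorem of_mul_oplus (x : A) {a b : A} (h : odot a b = zero) :
    of (x *ᴹ (a ⊕ᴹ b)) = of (x *ᴹ a) + of (x *ᴹ b) := by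
  have h1 := of_mul_ominus x (a := a ⊕ᴹ b) (b := b) (by rw [oplus_comm]; exact le_oplus _ _)
  rw [oplus_ominus_of_le_neg h] at h1
  rw [h1, sub_add_cancel]

theorem of_mul_odot (x : A) {a b : A} (h : a ⊕ᴹ b = unit) :
    of (x *ᴹ odot a b) = of (x *ᴹ a) + of (x *ᴹ b) - of (x *ᴹ unit) := by
  have hn : ¬ᴹb = ominus unit b := by unfold ominus; rw [neg_unit, zero_oplus]
  have hle : le ¬ᴹb a := by rw [oplus_comm] at h; exact oplus_eq_unit.1 h
  rw [odot_eq_ominus, of_mul_ominus x hle, hn, of_mul_ominus x (le_unit b)]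
  abel

protected theorem mul_add (x y z : Chang A) : x * (y + z) = x * y + x * z := by
  induction x using ind with | _ m a =>
  induction y using ind with | _ n b =>
  induction z using ind with | _ k c =>
  rcases odot_or b c with h | h
  · rw [mk_add_mk_of_odot n k h]
    simp only [mk_mul_mk]
    rw [MVWRig.mul_comm (b ⊕ᴹ c), of_mul_oplus _ h, of_mul_oplus _ h, MVWRig.mul_comm b unit,
      MVWRig.mul_comm c unit]
    simp only [mul_add, add_smul, smul_add]
    abel
  · rw [mk_add_mk_of_oplus n k h]
    simp only [mk_mul_mk]
    rw [MVWRig.mul_comm (odot b c), of_mul_odot _ h, of_mul_odot _ h, MVWRig.mul_comm b unit,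
      MVWRig.mul_comm c unit]
    simp only [mul_add, add_smul, smul_add, smul_sub, mul_one, one_smul]
    abel

protected theorem mul_comm (x y : Chang A) : x * y = y * x := by
  induction x using ind with | _ m a =>
  induction y using ind with | _ n b =>
  exact mulAux_comm _ _

noncomputable instance : NonUnitalNonAssocCommRing (Chang A) where
  left_distrib := Chang.mul_add
  right_distrib x y z := by
    rw [Chang.mul_comm, Chang.mul_add, Chang.mul_comm z, Chang.mul_comm z]
  zero_mul x := by
    have h := Chang.mul_add x 0 0
    rw [add_zero] at h
    rw [Chang.mul_comm]
    exact left_eq_add.1 h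
  mul_zero x := by
    have h := Chang.mul_add x 0 0
    rw [add_zero] at h
    exact left_eq_add.1 h
  mul_comm := Chang.mul_comm

theorem of_mul_of (a b : A) : of a * of b = of (a *ᴹ b) := by
  unfold of
  rw [mk_mul_mk]
  simp only [mul_zero, zero_smul, zero_add]
  rfl

/-- The ring `A^♯` of a `PMV_f`-chain `A`. -/
noncomputable instance : NonUnitalCommRing (Chang A) where
  mul_assoc x y z := by
    induction x using ind with | _ m a =>
    induction y using ind with | _ n b =>
    induction z using ind with | _ k c =>
    simp only [mk_eq, add_mul, mul_add, smul_mul_assoc, mul_smul_comm, of_mul_of,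
      MVWRig.mul_assoc]
  mul_comm := Chang.mul_comm

end MVAlgebra.Chang

/-! ### The ring of a `PMV_f`-algebra -/

namespace PMVf
open MVAlgebra

section
variable (A : Type u) [PMVf A]

/-- The `l`-ring `∏_P (A/P)^♯`, with the product over all prime ideals; operations and order are
componentwise. -/
abbrev ChangProd : Type u := ∀ P : Spec A, Chang (PrimeQuotient P)

variable {A} in
/-- The element `(0, â)` of `∏_P (A/P)^♯`. -/
def hat (a : A) : ChangProd A := fun P => Chang.of (PrimeQuotient.mk P a)

/-- `A^♯`: the `l`-subring (subring closed under the lattice operations) of `∏_P (A/P)^♯`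
generated by the elements `(0, â)`, `a ∈ A`. -/
noncomputable def sharpSubring : NonUnitalSubring (ChangProd A) :=
  sInf {S | (∀ a : A, hat a ∈ S) ∧ ∀ x ∈ S, ∀ y ∈ S, x ⊔ y ∈ S ∧ x ⊓ y ∈ S}

/-- The type of elements of `A^♯`. -/
abbrev Sharp : Type u := sharpSubring A

variable {A}

theorem hat_mem (a : A) : hat a ∈ sharpSubring A :=
  NonUnitalSubring.mem_sInf.2 fun _ hS => hS.1 a

theorem sup_mem {x y : ChangProd A} (hx : x ∈ sharpSubring A) (hy : y ∈ sharpSubring A) :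
    x ⊔ y ∈ sharpSubring A :=
  NonUnitalSubring.mem_sInf.2 fun S hS =>
    (hS.2 x (NonUnitalSubring.mem_sInf.1 hx S hS) y (NonUnitalSubring.mem_sInf.1 hy S hS)).1

theorem inf_mem {x y : ChangProd A} (hx : x ∈ sharpSubring A) (hy : y ∈ sharpSubring A) :
    x ⊓ y ∈ sharpSubring A :=
  NonUnitalSubring.mem_sInf.2 fun S hS =>
    (hS.2 x (NonUnitalSubring.mem_sInf.1 hx S hS) y (NonUnitalSubring.mem_sInf.1 hy S hS)).2

noncomputable instance : Lattice (Sharp A) :=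
  Subtype.lattice (fun _ _ hx hy => sup_mem hx hy) (fun _ _ hx hy => inf_mem hx hy)

/-- The canonical map `A → A^♯`, `a ↦ (0, â)`; the strong unit of `A^♯` is the image of `u`. -/
def toSharp (a : A) : Sharp A := ⟨hat a, hat_mem a⟩

end

end PMVf

/-- `B(ℤ^X)`, the ring of bounded functions `X → ℤ`. -/
def boundedInt (X : Type u) : Subring (X → ℤ) where
  carrier := {f | ∃ n : ℕ, ∀ x, |f x| ≤ n}
  zero_mem' := ⟨0, fun x => by simp⟩
  one_mem' := ⟨1, fun x => by simp⟩
  neg_mem' := by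
    rintro f ⟨n, hn⟩
    exact ⟨n, fun x => by simpa using hn x⟩
  add_mem' := by
    rintro f g ⟨n, hn⟩ ⟨k, hk⟩
    refine ⟨n + k, fun x => ?_⟩
    push_cast
    exact (abs_add_le _ _).trans (add_le_add (hn x) (hk x))
  mul_mem' := by
    rintro f g ⟨n, hn⟩ ⟨k, hk⟩
    refine ⟨n * k, fun x => ?_⟩
    push_cast
    rw [Pi.mul_apply, abs_mul]
    exact mul_le_mul (hn x) (hk x) (abs_nonneg _) (by positivity)

/-- The `0`-`1` valued function `X → ℤ` of an element of `2^X`. -/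
def indicatorInt {X : Type u} (f : X → Bool) (x : X) : ℤ := if f x = true then 1 else 0

/-! ### The ring of a two-element chain is ℤ -/

namespace MVAlgebra.Chang
open PMVf
variable {A : Type u} [PMVf A] [IsChain A]

/-! A prime ideal `P` of a Boolean algebra `B` contains `b` or its complement, so `B/P` has no
elements besides `0` and `u`, and `u² = u`. If `P` is proper, then `m ↦ (m, 0)` is an isomorphism of
ordered rings from ℤ to `(B/P)^♯`; if `P` is improper, the factor is trivial and carries no
information. Hence `B^♯` embeds, with its order and lattice operations, into the integer functions
on the proper primes (`coords`), and `ι(b)` becomes the indicator of the Stone set of `b`.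
Indicators are bounded and bounded functions form an `l`-ring, so the image consists of bounded
functions. This is the assertion on arbitrary Boolean algebras.

For `B = 2^X` there are far more primes than points, and the coordinates at the point ideals must be
shown to suffice. The complement of a proper prime is an ultrafilter on `X`. By induction on the
generation of `(2^X)^♯`, the coordinate of an element at `P` is the value that its point coordinates
take almost everywhere for that ultrafilter (`almostEq_coords`). An inequality that holds at all
points therefore passes to every `P`, as in Łoś's theorem (`pointHom_le_iff`), and injectivity
follows. Surjectivity onto the bounded functions holds because such a function has finitely many
values and is an integer combination of the indicators of its level sets (`eq_sum_indicatorInt`). On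
a finite set every function is bounded, which gives `ℤ^n`. -/

theorem mk_zero_mul_mk_zero (hu : (unit : A) *ᴹ unit = unit) (m n : ℤ) :
    mk m (zero : A) * mk n zero = mk (m * n) zero := by
  rw [mk_mul_mk, hu, MVWRig.mul_comm zero unit, MVWRig.mul_zero, MVWRig.mul_zero, of_zero,
    mk_zero_eq]
  simp

/-- If `u² = u`, the multiples of the unit form a copy of `ℤ` in `A^♯`. -/
noncomputable def intHom (hu : (unit : A) *ᴹ unit = unit) : ℤ →ₙ+* Chang A where
  toFun m := mk m zero
  map_mul' m n := (mk_zero_mul_mk_zero hu m n).symm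
  map_zero' := rfl
  map_add' m n := by rw [mk_zero_eq, mk_zero_eq, mk_zero_eq, add_smul]

/-- Nontriviality is essential: if `0 = u`, all pairs are identified and every comparison holds. -/
theorem intHom_le_iff (hu : (unit : A) *ᴹ unit = unit) (h0 : (zero : A) ≠ unit) {m n : ℤ} :
    intHom (A := A) hu m ≤ intHom hu n ↔ m ≤ n := by
  change mk m zero ≤ mk n zero ↔ _
  rw [mk_le_mk_iff h0]
  -- Since `0 ≠ u`, the pairs `(m, 0)` and `(n, 0)` are already in normal form.
  simp only [nf, if_neg h0, lexLe, le_refl, and_true]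
  exact le_iff_lt_or_eq.symm

theorem intHom_bijective (hu : (unit : A) *ᴹ unit = unit) (h0 : (zero : A) ≠ unit)
    (h : ∀ a : A, a = zero ∨ a = unit) : Function.Bijective (intHom (A := A) hu) := by
  refine ⟨fun m n e => ?_, fun x => ?_⟩
  · exact _root_.le_antisymm ((intHom_le_iff hu h0).1 e.le) ((intHom_le_iff hu h0).1 e.ge)
  · induction x using ind with | _ m a =>
    rcases h a with rfl | rfl
    · exact ⟨m, rfl⟩
    -- The gluing `(m, u) = (m + 1, 0)` shifts the preimage by one.
    · exact ⟨m + 1, glue m⟩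

end MVAlgebra.Chang

/-! ### Prime quotients of a Boolean algebra, Stone representation and integer coordinates -/

namespace PMVf
open MVAlgebra

section Boolean
variable {B : Type u} [BooleanAlgebra B]

theorem boolean_le_iff {a b : B} : MVAlgebra.le a b ↔ a ≤ b := by
  change (aᶜ ⊔ b)ᶜ = ⊥ ↔ a ≤ b
  rw [compl_eq_bot, _root_.sup_comm, ← himp_eq, himp_eq_top_iff]

theorem boolean_inf_eq (a b : B) : MVAlgebra.inf a b = a ⊓ b := by
  change ((aᶜᶜ ⊔ bᶜ)ᶜ ⊔ bᶜ)ᶜ = a ⊓ b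
  simp only [compl_sup, compl_compl, compl_inf]
  rw [inf_sup_right, compl_inf_eq_bot, sup_bot_eq]

section
variable (P : Spec B)

theorem mem_of_le {a b : B} (h : a ≤ b) (hb : b ∈ P.1) : a ∈ P.1 :=
  P.2.down (boolean_le_iff.2 h) hb

theorem inf_mem_iff {a b : B} : a ⊓ b ∈ P.1 ↔ a ∈ P.1 ∨ b ∈ P.1 := by
  refine ⟨fun h => P.2.prime (by rwa [boolean_inf_eq]), ?_⟩
  rintro (h | h)
  · exact mem_of_le P inf_le_left h
  · exact mem_of_le P inf_le_right h

theorem sup_mem_iff {a b : B} : a ⊔ b ∈ P.1 ↔ a ∈ P.1 ∧ b ∈ P.1 :=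
  ⟨fun h => ⟨mem_of_le P le_sup_left h, mem_of_le P le_sup_right h⟩,
    fun h => P.2.oplus_mem h.1 h.2⟩

theorem bot_mem : (⊥ : B) ∈ P.1 := P.2.toIsIdeal.zero_mem

/-- The meet of `b` and its complement is `⊥`, which lies in `P`, and `P` is prime. -/
theorem mem_or_compl_mem (b : B) : b ∈ P.1 ∨ bᶜ ∈ P.1 := by
  rw [← inf_mem_iff, inf_compl_self]
  exact bot_mem P

theorem mk_eq_unit {b : B} (h : bᶜ ∈ P.1) : PrimeQuotient.mk P b = unit := by
  apply MVAlgebra.neg_inj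
  rw [neg_unit]
  exact PrimeQuotient.mk_eq_zero P h

theorem primeQuotient_eq (a : PrimeQuotient P) : a = zero ∨ a = unit := by
  induction a using PrimeQuotient.ind with | _ b =>
  exact (mem_or_compl_mem P b).imp (PrimeQuotient.mk_eq_zero P) (mk_eq_unit P)

theorem primeQuotient_unit_mul : (unit : PrimeQuotient P) *ᴹ unit = unit :=
  congrArg (PrimeQuotient.mk P) (inf_idem (unit : B))

theorem primeQuotient_zero_ne (hP : (⊤ : B) ∉ P.1) : (zero : PrimeQuotient P) ≠ unit := by
  intro h
  have h1 : cong P.1 (zero : B) unit := Quotient.exact (s := primeSetoid P.2) h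
  have h2 := ((cong_iff P.2.toIsIdeal).1 h1).2
  apply hP
  convert h2
  -- The right side is `u ⊖ 0` written out in Boolean terms; it lies in `P` once `0` and `u` are
  -- congruent.
  change (⊤ : B) = ((⊥ᶜ)ᶜ ⊔ ⊥)ᶜ
  simp

/-- Modulo the improper ideal `0 = u`, so this factor of the product is a single point and can be
omitted from the coordinates. -/
theorem chang_subsingleton (hP : (⊤ : B) ∈ P.1) : Subsingleton (Chang (PrimeQuotient P)) := by
  refine Chang.subsingleton_of_eq ?_
  rw [← PrimeQuotient.mk_eq_zero P hP, mk_eq_unit P (b := ⊤)]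
  rw [compl_top]; exact bot_mem P

end

variable (B) in
/-- The proper prime ideals of `B`. -/
def ProperSpec : Type u := {P : Spec B // (⊤ : B) ∉ P.1}

theorem ProperSpec.compl_mem_iff (P : ProperSpec B) {b : B} : bᶜ ∈ P.1.1 ↔ b ∉ P.1.1 := by
  refine ⟨fun h h' => P.2 ?_, (mem_or_compl_mem P.1 b).resolve_left⟩
  have := (sup_mem_iff P.1).2 ⟨h', h⟩
  rwa [sup_compl_eq_top] at this

/-- `(B/P)^♯` is `ℤ` for a proper prime ideal `P` of a Boolean algebra `B`. -/
noncomputable def evalEquiv (P : ProperSpec B) : Chang (PrimeQuotient P.1) ≃+* ℤ :=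
  let f := Equiv.ofBijective (Chang.intHom (primeQuotient_unit_mul P.1))
    (Chang.intHom_bijective _ (primeQuotient_zero_ne P.1 P.2) (primeQuotient_eq P.1))
  RingEquiv.symm { f with
    map_mul' := map_mul (Chang.intHom (primeQuotient_unit_mul P.1))
    map_add' := map_add (Chang.intHom (primeQuotient_unit_mul P.1)) }

theorem evalEquiv_symm_apply (P : ProperSpec B) (m : ℤ) :
    (evalEquiv P).symm m = Chang.mk m zero := rfl

theorem evalEquiv_mk_zero (P : ProperSpec B) (m : ℤ) :
    evalEquiv P (Chang.mk m zero) = m := by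
  rw [← evalEquiv_symm_apply, RingEquiv.apply_symm_apply]

theorem evalEquiv_le_iff (P : ProperSpec B) {x y : Chang (PrimeQuotient P.1)} :
    evalEquiv P x ≤ evalEquiv P y ↔ x ≤ y := by
  rw [← Chang.intHom_le_iff (primeQuotient_unit_mul P.1) (primeQuotient_zero_ne P.1 P.2)]
  change (evalEquiv P).symm _ ≤ (evalEquiv P).symm _ ↔ _
  simp

theorem evalEquiv_monotone (P : ProperSpec B) : Monotone (evalEquiv P) :=
  fun _ _ h => (evalEquiv_le_iff P).2 h

/-- The proper prime ideals of `B` represent `B` by sets. -/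
noncomputable def stone (b : B) : ProperSpec B → Bool :=
  open Classical in fun P => decide (b ∉ P.1.1)

theorem stone_eq_true {b : B} {P : ProperSpec B} : stone b P = true ↔ b ∉ P.1.1 := by
  simp [stone]

/-- At each `P` this is the quotient map onto the two-element algebra `B/P`. Closure of the ideal
under joins gives `⊕`, primeness gives the product, and properness is what makes negation work. -/
theorem stone_isHom : IsHom (stone (B := B)) where
  map_zero := by
    funext P
    change stone ⊥ P = false
    rw [← Bool.not_eq_true, stone_eq_true, not_not]
    exact bot_mem P.1
  map_oplus a b := by
    funext P
    change stone (a ⊔ b) P = (stone a P || stone b P)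
    rw [Bool.eq_iff_iff, Bool.or_eq_true, stone_eq_true, stone_eq_true, stone_eq_true,
      sup_mem_iff, not_and_or]
  map_neg a := by
    funext P
    change stone aᶜ P = !(stone a P)
    rw [Bool.eq_iff_iff, Bool.not_eq_true', ← Bool.not_eq_true, stone_eq_true, stone_eq_true,
      P.compl_mem_iff]
  map_mul a b := by
    funext P
    change stone (a ⊓ b) P = (stone a P && stone b P)
    rw [Bool.eq_iff_iff, Bool.and_eq_true, stone_eq_true, stone_eq_true, stone_eq_true,
      inf_mem_iff, not_or]

/-- The prime ideal theorem: prime ideals separate the elements of a Boolean algebra. -/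
theorem exists_properSpec {a b : B} (h : ¬ a ≤ b) : ∃ P : ProperSpec B, b ∈ P.1.1 ∧ a ∉ P.1.1 := by
  -- The filter above `a` and the ideal below `b` are disjoint because `a ≤ b` fails; a prime ideal
  -- containing the latter and missing the former separates `b` from `a`.
  obtain ⟨J, hJ, hb, hd⟩ := DistribLattice.prime_ideal_of_disjoint_filter_ideal
    (F := Order.PFilter.principal a) (I := Order.Ideal.principal b) (by
      rw [Set.disjoint_left]
      intro c hc hc'
      exact h (_root_.le_trans (Order.PFilter.mem_principal.1 hc) (Order.Ideal.mem_principal.1 hc')))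
  have ha : a ∉ J := Set.disjoint_left.1 hd (Order.PFilter.mem_principal.2 _root_.le_rfl)
  have hP : MVAlgebra.IsPrime (J : Set B) :=
    { nonempty := J.nonempty
      down := fun h hb => J.lower (boolean_le_iff.1 h) hb
      oplus_mem := fun h h' => Order.Ideal.sup_mem h h'
      prime := fun {x y} h => hJ.mem_or_mem (by rwa [boolean_inf_eq] at h) }
  exact ⟨⟨⟨J, hP⟩, fun ht => ha (J.lower le_top ht)⟩, hb Order.Ideal.mem_principal_self, ha⟩

theorem stone_injective : Function.Injective (stone (B := B)) := by
  have key : ∀ a b : B, stone a = stone b → a ≤ b := by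
    intro a b e
    by_contra h
    obtain ⟨P, hb, ha⟩ := exists_properSpec h
    rw [← stone_eq_true, e, stone_eq_true] at ha
    exact ha hb
  exact fun a b e => _root_.le_antisymm (key a b e) (key b a e.symm)

/-- If `b ∉ P`, the class of `b` is `u` and `(0, u) = (1, 0)` has coordinate 1; otherwise the class
is `0`. -/
theorem evalEquiv_hat (P : ProperSpec B) (b : B) :
    evalEquiv P (hat b P.1) = indicatorInt (stone b) P := by
  unfold indicatorInt hat
  split_ifs with h
  · rw [stone_eq_true, ← P.compl_mem_iff] at h
    rw [mk_eq_unit P.1 h, Chang.of, ← Chang.glue, evalEquiv_mk_zero]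
    rfl
  · rw [stone_eq_true, not_not] at h
    rw [PrimeQuotient.mk_eq_zero P.1 h, Chang.of, evalEquiv_mk_zero]

/-- The integer coordinates of an element of `∏_P (B/P)^♯`. -/
noncomputable def coords : ChangProd B →ₙ+* (ProperSpec B → ℤ) where
  toFun z P := evalEquiv P (z P.1)
  map_mul' _ _ := funext fun P => map_mul (evalEquiv P) _ _
  map_zero' := funext fun P => map_zero (evalEquiv P)
  map_add' _ _ := funext fun P => map_add (evalEquiv P) _ _

/-- The coordinates range over proper primes only, yet they reflect the order of the whole product,
since the remaining factor is trivial. -/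
theorem coords_le_iff {z w : ChangProd B} : coords z ≤ coords w ↔ z ≤ w := by
  refine ⟨fun h P => ?_, fun h P => (evalEquiv_le_iff P).2 (h P.1)⟩
  by_cases hP : (⊤ : B) ∈ P.1
  · have := chang_subsingleton P hP
    exact (Subsingleton.elim _ _).le
  · exact (evalEquiv_le_iff ⟨P, hP⟩).1 (h ⟨P, hP⟩)

/-- Each factor is a chain, and a monotone map between chains preserves maxima. -/
theorem coords_sup (z w : ChangProd B) : coords (z ⊔ w) = coords z ⊔ coords w :=
  funext fun P => (evalEquiv_monotone P).map_sup _ _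

theorem coords_inf (z w : ChangProd B) : coords (z ⊓ w) = coords z ⊓ coords w :=
  funext fun P => (evalEquiv_monotone P).map_inf _ _

theorem coords_hat (b : B) : coords (hat b) = indicatorInt (stone b) :=
  funext fun P => evalEquiv_hat P b

/-- The elements satisfying `p` form one of the `l`-subrings containing the generators, whose
intersection is `B^♯`. -/
theorem sharp_induction {p : ChangProd B → Prop} (hat_ : ∀ b, p (hat b)) (zero_ : p 0)
    (add_ : ∀ x y, p x → p y → p (x + y)) (neg_ : ∀ x, p x → p (-x))
    (mul_ : ∀ x y, p x → p y → p (x * y)) (sup_ : ∀ x y, p x → p y → p (x ⊔ y))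
    (inf_ : ∀ x y, p x → p y → p (x ⊓ y)) {z : ChangProd B} (hz : z ∈ sharpSubring B) : p z := by
  let S : NonUnitalSubring (ChangProd B) :=
    { carrier := {x | p x}
      zero_mem' := zero_
      add_mem' := fun {x y} => add_ x y
      neg_mem' := fun {x} => neg_ x
      mul_mem' := fun {x y} => mul_ x y }
  exact NonUnitalSubring.mem_sInf.1 hz S
    ⟨hat_, fun x hx y hy => ⟨sup_ x y hx hy, inf_ x y hx hy⟩⟩

end Boolean

end PMVf

/-! ### Bounded integer functions -/

theorem indicatorInt_mem {X : Type u} (f : X → Bool) : indicatorInt f ∈ boundedInt X := by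
  refine ⟨1, fun x => ?_⟩
  unfold indicatorInt
  split_ifs <;> simp

theorem sup_mem_boundedInt {X : Type u} {f g : X → ℤ} (hf : f ∈ boundedInt X)
    (hg : g ∈ boundedInt X) : f ⊔ g ∈ boundedInt X := by
  obtain ⟨n, hn⟩ := hf
  obtain ⟨k, hk⟩ := hg
  refine ⟨max n k, fun x => (abs_max_le_max_abs_abs).trans ?_⟩
  push_cast
  exact max_le_max (hn x) (hk x)

theorem inf_mem_boundedInt {X : Type u} {f g : X → ℤ} (hf : f ∈ boundedInt X)
    (hg : g ∈ boundedInt X) : f ⊓ g ∈ boundedInt X := by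
  obtain ⟨n, hn⟩ := hf
  obtain ⟨k, hk⟩ := hg
  refine ⟨max n k, fun x => (abs_min_le_max_abs_abs).trans ?_⟩
  push_cast
  exact max_le_max (hn x) (hk x)

/-- A bounded function is a finite integer combination of indicators. -/
theorem eq_sum_indicatorInt {X : Type u} {f : X → ℤ} {N : ℕ} (hN : ∀ x, |f x| ≤ N) :
    f = ∑ n ∈ Finset.Icc (-(N : ℤ)) N, n • indicatorInt (fun x => decide (f x = n)) := by
  funext x
  have := abs_le.1 (hN x)
  -- At `x` only the level set of the value `n = f x` contributes, and the bound puts this `n` in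
  -- the range of summation.
  rw [Finset.sum_apply, Finset.sum_eq_single (f x)]
  · simp [indicatorInt]
  · intro n _ hn
    simp [indicatorInt, hn.symm]
  · intro h
    exact absurd (Finset.mem_Icc.2 this) h

/-! ### The embedding of `B^♯` into bounded functions -/

namespace PMVf
open MVAlgebra

section Boolean
variable {B : Type u} [BooleanAlgebra B]

/-- Boundedness holds for the generators, whose coordinates are indicators, and survives all
`l`-ring operations. -/
theorem coords_mem {z : ChangProd B} (hz : z ∈ sharpSubring B) :
    coords z ∈ boundedInt (ProperSpec B) := by
  refine sharp_induction (p := fun z => coords z ∈ boundedInt (ProperSpec B))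
    ?hat ?zero ?add ?neg ?mul ?sup ?inf hz
  case hat =>
    intro b
    rw [coords_hat]
    exact indicatorInt_mem _
  case zero =>
    rw [map_zero]
    exact zero_mem _
  case add =>
    intro x y hx hy
    rw [map_add]
    exact add_mem hx hy
  case neg =>
    intro x hx
    rw [map_neg]
    exact neg_mem hx
  case mul =>
    intro x y hx hy
    rw [map_mul]
    exact mul_mem hx hy
  case sup =>
    intro x y hx hy
    rw [coords_sup]
    exact sup_mem_boundedInt hx hy
  case inf =>
    intro x y hx hy
    rw [coords_inf]
    exact inf_mem_boundedInt hx hy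

/-- The ring `B^♯` of a Boolean algebra as a ring of bounded integer functions. -/
noncomputable def sharpHom : Sharp B →ₙ+* boundedInt (ProperSpec B) where
  toFun z := ⟨coords z.1, coords_mem z.2⟩
  map_mul' z w := Subtype.ext (map_mul coords z.1 w.1)
  map_zero' := Subtype.ext (map_zero coords)
  map_add' z w := Subtype.ext (map_add coords z.1 w.1)

theorem sharpHom_le_iff (x y : Sharp B) : sharpHom x ≤ sharpHom y ↔ x ≤ y := coords_le_iff

end Boolean

/-! ### Power sets: point coordinates determine all coordinates -/

section PowerSet
variable {X : Type u}

/-- The prime ideal of the subsets of `X` that omit a given point. -/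
def pointSpec (x : X) : ProperSpec (X → Bool) :=
  ⟨⟨{f | f x = false},
    { nonempty := ⟨⊥, rfl⟩
      down := fun {a b} h hb => by
        have h1 := boolean_le_iff.1 h x
        rw [show b x = false from hb] at h1
        exact le_bot_iff.1 h1
      oplus_mem := fun {a b} ha hb => by
        change (a x || b x) = false
        rw [show a x = false from ha, show b x = false from hb]; rfl
      prime := fun {a b} h => by
        rw [boolean_inf_eq] at h
        exact Bool.and_eq_false_iff.1 h }⟩, fun h => Bool.noConfusion (show true = false from h)⟩

theorem mem_pointSpec {x : X} {f : X → Bool} : f ∈ (pointSpec x).1.1 ↔ f x = false := Iff.rfl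

/-- `g x` is the constant `m` for almost all `x`, with respect to the ultrafilter of the
complement of `P`. -/
def AlmostEq (P : ProperSpec (X → Bool)) (g : X → ℤ) (m : ℤ) : Prop :=
  (fun x => decide (g x = m)) ∉ P.1.1

/-- Two level sets outside `P` have their meet outside `P` by primeness, and on that meet `op` takes
the required value. As `op` is arbitrary, this covers the ring and lattice operations and also the
comparison of two functions. -/
theorem AlmostEq.map₂ {P : ProperSpec (X → Bool)} {g g' : X → ℤ} {m m' : ℤ} (h : AlmostEq P g m)
    (h' : AlmostEq P g' m') (op : ℤ → ℤ → ℤ) :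
    AlmostEq P (fun x => op (g x) (g' x)) (op m m') := by
  intro h2
  have : (fun x => decide (g x = m)) ⊓ (fun x => decide (g' x = m')) ∈ P.1.1 := by
    refine mem_of_le P.1 (fun x => ?_) h2
    change (decide (g x = m) && decide (g' x = m')) ≤ decide (op (g x) (g' x) = op m m')
    rw [Bool.le_iff_imp]
    simp only [Bool.and_eq_true, decide_eq_true_eq]
    rintro ⟨rfl, rfl⟩
    rfl
  exact ((inf_mem_iff P.1).1 this).elim h h'

/-- A set outside `P` is nonempty, since `⊥ ∈ P`. -/
theorem AlmostEq.exists {P : ProperSpec (X → Bool)} {g : X → ℤ} {m : ℤ} (h : AlmostEq P g m) :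
    ∃ x, g x = m := by
  by_contra! h'
  apply h
  have : (fun x => decide (g x = m)) = ⊥ := funext fun x => decide_eq_false (h' x)
  rw [this]
  exact bot_mem P.1

theorem almostEq_pointSpec {x : X} {g : X → ℤ} {m : ℤ} :
    AlmostEq (pointSpec x) g m ↔ g x = m := by
  unfold AlmostEq
  rw [mem_pointSpec]
  simp

/-- If `f ∈ P`, the coordinate is 0 and the level set is the complement of `f`; otherwise the
coordinate is 1 and the level set is `f` itself. -/
theorem almostEq_indicatorInt (P : ProperSpec (X → Bool)) (f : X → Bool) :
    AlmostEq P (indicatorInt f) (indicatorInt (stone f) P) := by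
  unfold AlmostEq
  by_cases h : f ∈ P.1.1
  · rw [← P.compl_mem_iff]
    convert h using 1
    funext x
    have : ¬ stone f P = true := by rwa [stone_eq_true, not_not]
    cases hx : f x <;> simp [indicatorInt, this, hx]
  · convert h using 2
    funext x
    rw [← stone_eq_true] at h
    cases hx : f x <;> simp [indicatorInt, h, hx]

/-- A single `g` must serve all `P` at once: only then can it be identified afterwards by evaluation
at the point ideals. -/
theorem exists_almostEq {z : ChangProd (X → Bool)} (hz : z ∈ sharpSubring (X → Bool)) :
    ∃ g : X → ℤ, ∀ P, AlmostEq P g (coords z P) := by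
  refine sharp_induction (p := fun z => ∃ g : X → ℤ, ∀ P, AlmostEq P g (coords z P))
    ?hat ?zero ?add ?neg ?mul ?sup ?inf hz
  case hat =>
    intro f
    rw [coords_hat]
    exact ⟨indicatorInt f, fun P => almostEq_indicatorInt P f⟩
  case zero =>
    rw [map_zero]
    refine ⟨0, fun P h => P.2 ?_⟩
    -- The level set is all of `X`, so its membership in `P` would make `P` improper.
    exact mem_of_le P.1 (fun x => (decide_eq_true (rfl : (0 : X → ℤ) x = 0)).ge) h
  case add =>
    rintro x y ⟨g, hg⟩ ⟨k, hk⟩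
    rw [map_add]
    exact ⟨_, fun P => (hg P).map₂ (hk P) (· + ·)⟩
  case neg =>
    rintro x ⟨g, hg⟩
    rw [map_neg]
    exact ⟨_, fun P => (hg P).map₂ (hg P) fun m _ => -m⟩
  case mul =>
    rintro x y ⟨g, hg⟩ ⟨k, hk⟩
    rw [map_mul]
    exact ⟨_, fun P => (hg P).map₂ (hk P) (· * ·)⟩
  case sup =>
    rintro x y ⟨g, hg⟩ ⟨k, hk⟩
    rw [coords_sup]
    exact ⟨_, fun P => (hg P).map₂ (hk P) (· ⊔ ·)⟩
  case inf =>
    rintro x y ⟨g, hg⟩ ⟨k, hk⟩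
    rw [coords_inf]
    exact ⟨_, fun P => (hg P).map₂ (hk P) (· ⊓ ·)⟩

/-- The coordinates of an element of `(2^X)^♯` at the points of `X` determine the others. -/
theorem almostEq_coords {z : ChangProd (X → Bool)} (hz : z ∈ sharpSubring (X → Bool))
    (P : ProperSpec (X → Bool)) :
    AlmostEq P (fun x => coords z (pointSpec x)) (coords z P) := by
  obtain ⟨g, hg⟩ := exists_almostEq hz
  -- For a point ideal, almost equality is equality at the point, so `g` is the function of point
  -- coordinates.
  convert hg P using 1
  funext x
  exact (almostEq_pointSpec.1 (hg (pointSpec x))).symm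

/-- The values of an element of `(2^X)^♯` at the points of `X`. -/
noncomputable def pointHom : Sharp (X → Bool) →ₙ+* boundedInt X where
  toFun z := ⟨fun x => coords z.1 (pointSpec x),
    let ⟨n, hn⟩ := coords_mem z.2
    ⟨n, fun x => hn (pointSpec x)⟩⟩
  map_mul' z w := Subtype.ext (funext fun x => congrFun (map_mul coords z.1 w.1) (pointSpec x))
  map_zero' := Subtype.ext (funext fun x => congrFun (map_zero coords) (pointSpec x))
  map_add' z w := Subtype.ext (funext fun x => congrFun (map_add coords z.1 w.1) (pointSpec x))

/-- Łoś's principle: an inequality at all points passes to every ultrafilter on `X`. -/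
theorem pointHom_le_iff (z w : Sharp (X → Bool)) : pointHom z ≤ pointHom w ↔ z ≤ w := by
  refine ⟨fun h => (sharpHom_le_iff z w).1 fun P => ?_,
    fun h x => (sharpHom_le_iff z w).2 h (pointSpec x)⟩
  -- The truth value of the inequality is encoded as 0 or 1, so that it is itself an operation on
  -- integers. Its value at `P` is attained at some point, and at points it is 1.
  have key := ((almostEq_coords z.2 P).map₂ (almostEq_coords w.2 P))
    fun m n => if m ≤ n then 1 else 0
  obtain ⟨x, hx⟩ := key.exists
  have hx' : coords z.1 (pointSpec x) ≤ coords w.1 (pointSpec x) := h x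
  rw [if_pos hx'] at hx
  by_contra hlt
  exact one_ne_zero (hx.trans (if_neg hlt))

theorem pointHom_toSharp (f : X → Bool) : (pointHom (toSharp f) : X → ℤ) = indicatorInt f := by
  funext x
  change coords (hat f) (pointSpec x) = _
  rw [coords_hat]
  unfold indicatorInt
  simp only [stone_eq_true, mem_pointSpec, Bool.not_eq_false]

theorem pointHom_bijective : Function.Bijective (pointHom (X := X)) := by
  refine ⟨fun z w e => ?_, fun f => ?_⟩
  · exact _root_.le_antisymm ((pointHom_le_iff z w).1 e.le) ((pointHom_le_iff w z).1 e.ge)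
  · obtain ⟨N, hN⟩ := f.2
    -- The preimage is the level-set decomposition of `f`, formed in `(2^X)^♯` from the generators
    -- of its level sets.
    refine ⟨∑ n ∈ Finset.Icc (-(N : ℤ)) N, n • toSharp (fun x => decide (f.1 x = n)), ?_⟩
    apply Subtype.ext
    rw [map_sum, AddSubmonoidClass.coe_finsetSum]
    refine Eq.trans (Finset.sum_congr rfl fun n _ => ?_) (eq_sum_indicatorInt hN).symm
    rw [map_zsmul, ← pointHom_toSharp]
    rfl

/-- `(2^X)^♯ ≅ B(ℤ^X)`. -/
noncomputable def pointEquiv : Sharp (X → Bool) ≃+* boundedInt X :=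
  { Equiv.ofBijective pointHom pointHom_bijective with
    map_mul' := map_mul pointHom
    map_add' := map_add pointHom }

end PowerSet

end PMVf

/-! ### Finite exponents and the theorem -/

theorem boundedInt_eq_top (X : Type u) [Finite X] : boundedInt X = ⊤ := by
  refine top_le_iff.1 fun f _ => ?_
  obtain ⟨N, hN⟩ := (Set.finite_range fun x => (f x).natAbs).bddAbove
  refine ⟨N, fun x => ?_⟩
  rw [Int.abs_eq_natAbs]
  exact_mod_cast hN (Set.mem_range_self x)

/-- All functions on a finite set are bounded. -/
def boundedIntEquiv (X : Type u) [Finite X] : boundedInt X ≃+* (X → ℤ) :=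
  (RingEquiv.subringCongr (boundedInt_eq_top X)).trans Subring.topEquiv

theorem mainTheorem10 :
    -- `(2^X)^♯ ≅ B(ℤ^X)`, as lattice-ordered rings, extending `2^X ⊆ ℤ^X`
    (∀ X : Type u, ∃ e : PMVf.Sharp (X → Bool) ≃+* boundedInt X,
      (∀ x y, e x ≤ e y ↔ x ≤ y) ∧
      ∀ f : X → Bool, (e (PMVf.toSharp f) : X → ℤ) = indicatorInt f) ∧
    -- `(2^n)^♯ ≅ ℤ^n`
    (∀ n : ℕ, ∃ e : PMVf.Sharp (Fin n → Bool) ≃+* (Fin n → ℤ),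
      (∀ x y, e x ≤ e y ↔ x ≤ y) ∧
      ∀ f : Fin n → Bool, e (PMVf.toSharp f) = indicatorInt f) ∧
    -- every Boolean algebra is a subalgebra of some `2^X`, and its ring a subring of `B(ℤ^X)`
    (∀ (B : Type u) [BooleanAlgebra B], ∃ (X : Type u) (h : B → (X → Bool)),
      PMVf.IsHom h ∧ Function.Injective h ∧
      ∃ j : PMVf.Sharp B →ₙ+* boundedInt X, Function.Injective j ∧
        (∀ x y : PMVf.Sharp B, j x ≤ j y ↔ x ≤ y) ∧
        (∀ x y : PMVf.Sharp B, (j (x ⊔ y) : X → ℤ) = (j x : X → ℤ) ⊔ (j y : X → ℤ) ∧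
          (j (x ⊓ y) : X → ℤ) = (j x : X → ℤ) ⊓ (j y : X → ℤ)) ∧
        ∀ b : B, (j (PMVf.toSharp b) : X → ℤ) = indicatorInt (h b)) := by
  refine ⟨fun X => ⟨PMVf.pointEquiv, PMVf.pointHom_le_iff, PMVf.pointHom_toSharp⟩,
    fun n => ⟨PMVf.pointEquiv.trans (boundedIntEquiv (Fin n)), PMVf.pointHom_le_iff,
      PMVf.pointHom_toSharp⟩,
    fun B _ => ⟨PMVf.ProperSpec B, PMVf.stone, PMVf.stone_isHom, PMVf.stone_injective,
      PMVf.sharpHom, fun x y e => ?_, PMVf.sharpHom_le_iff,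
      -- As `j` need not be surjective, preservation of `∨` and `∧` does not follow from the order
      -- embedding; it holds coordinatewise.
      fun x y => ⟨PMVf.coords_sup _ _, PMVf.coords_inf _ _⟩, PMVf.coords_hat⟩⟩
  -- A map that reflects the order is injective, by antisymmetry.
  exact le_antisymm ((PMVf.sharpHom_le_iff x y).1 e.le) ((PMVf.sharpHom_le_iff y x).1 e.ge)
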